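/- **Setting.** Let $E$ be a complex Hilbert space which is the Hilbert direct sum of closed, mutually orthogonal subspaces $V_\lambda$, $\lambda\in\mathbb Z$ (the subspaces of local quantum number $\lambda$). Let $\Pi_\lambda$ be the orthogonal projection onto $V_\lambda$, and for an integer $\Lambda\ge 0$ put $\Pi_{[-\Lambda,\Lambda]}=\sum_{|\lambda|\le\Lambda}\Pi_\lambda$ and $\overline\Pi_{[-\Lambda,\Lambda]}=I-\Pi_{[-\Lambda,\Lambda]}$. Let $\chi>0$ and $0\le r<1$ be real, and let $H=H_W+H_R$ be a (possibly unbounded) Hamiltonian on $E$: $H$ and $H_R$ are self-adjoint, and $H$ is a self-adjoint extension of the operator sum $H_W+H_R$ on $D(H_W)\cap D(H_R)$ (for instance the sum itself, if it is self-adjoint, or its closure, if it is essentially self-adjoint). Assume that * $\Pi_\lambda H_W\Pi_{\lambda'}=0$ whenever $|\lambda-\lambda'|>1$; * for every integer $\Lambda\ge0$ the operator $H_W\Pi_{[-\Lambda,\Lambda]}$ is defined on all of $E$ and $\|H_W\Pi_{[-\Lambda,\Lambda]}\|\le\chi(\Lambda+1)^r$; * $[H_R,\Pi_\lambda]=0$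 for every $\lambda$, that is, $\Pi_\lambda$ maps $D(H_R)$ into itself and $H_R\Pi_\lambda=\Pi_\lambda H_R$ on $D(H_R)$. Let $e^{-itH}$, $t\in\mathbb R$, be the strongly continuous unitary group with generator $-iH$. **Theorem (state truncation).** 1. There are a real polynomial $p$ in three variables and a constant $c>0$, both universal (independent of $E$, $H$, $\chi$, $r$, $t$, $\Lambda_0$, $\Lambda$), such that in the above setting, for all $t\ge0$ and all integers $\Lambda\ge\Lambda_0\ge0$, $$\left\|\overline\Pi_{[-\Lambda,\Lambda]}e^{-itH}\Pi_{[-\Lambda_0,\Lambda_0]}\right\|\le p(\chi t,\Lambda_0,\Lambda)\,\exp\left(-c\,\frac{\Lambda^{1-r}-\Lambda_0^{1-r}}{2(1-r)\chi t+1}\right).$$ 2. For real $a\ge0$, $t\in\mathbb R$ and an integer $\Delta>1$ let $$J(a,t)=\left\lceil\frac{\left(a^{1-r}+2\chi|t|(1-r)(\Delta-1)\right)^{1/(1-r)}-a}{\Delta-1}\right\rceil .$$ In the above setting let $t\in\mathbb R$, and let $\Lambda_0\ge0$ and $\Delta>1$ be integers. (a) If $\Lambda_0\ge1$ or $(1-r)(\Delta-1)^r\ge1$,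 then with $J=J(\Lambda_0,t)$ and $\Lambda(t)=\Lambda_0+J\,(\Delta-1)$, $$\left\|\overline\Pi_{[-\Lambda(t),\Lambda(t)]}e^{-itH}\Pi_{[-\Lambda_0,\Lambda_0]}\right\|\le\frac{J}{2^{\Delta-1}(\Delta!)^{1-r}}.$$ (b) Without any such restriction the same inequality holds with $J=J(\Lambda_0+1,t)$ and $\Lambda(t)=\Lambda_0+J\,(\Delta-1)$. -/

import Mathlib

open scoped Nat InnerProductSpace

noncomputable section

/-- `U` is the unitary group `t ↦ e^{-itH}` of the (possibly unbounded) operator `H`: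
a strongly continuous one-parameter group of unitary operators whose infinitesimal generator,
with its exact domain, is `-iH`.  For a self-adjoint `H` there is exactly one such `U`. -/
structure IsTimeEvolution {E : Type*} [NormedAddCommGroup E] [InnerProductSpace ℂ E]
    [CompleteSpace E] (H : E →ₗ.[ℂ] E) (U : ℝ → E →L[ℂ] E) : Prop where
  mem_unitary : ∀ t, U t ∈ unitary (E →L[ℂ] E)
  map_add : ∀ s t, U (s + t) = U s * U t
  continuous_apply : ∀ x, Continuous fun t => U t x
  mem_graph_iff : ∀ x y : E,
    (x, y) ∈ H.graph ↔ HasDerivAt (fun t : ℝ => U t x) (-Complex.I • y) 0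

/-- The projection `Π_{[-Λ,Λ]} = ∑_{|l| ≤ Λ} Π_l`, where `Π_l` is the orthogonal projection
onto the subspace `V l` of quantum number `l`. -/
def windowProj {E : Type*} [NormedAddCommGroup E] [InnerProductSpace ℂ E]
    (V : ℤ → Submodule ℂ E) [∀ l, CompleteSpace (V l)] (Λ : ℕ) : E →L[ℂ] E :=
  ∑ l ∈ Finset.Icc (-(Λ : ℤ)) (Λ : ℤ), (V l).starProjection

/-- The leakage `‖(I - Π_{[-Λ,Λ]}) u Π_{[-Λ₀,Λ₀]}‖` of the operator `u`. -/
def leakage {E : Type*} [NormedAddCommGroup E] [InnerProductSpace ℂ E]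
    (V : ℤ → Submodule ℂ E) [∀ l, CompleteSpace (V l)] (u : E →L[ℂ] E) (Λ₀ Λ : ℕ) : ℝ :=
  ‖(1 - windowProj V Λ) * u * windowProj V Λ₀‖

/-- `E` is the Hilbert direct sum of the subspaces `V l`, `l ∈ ℤ`, and `H = HW + HR`, where `HW`
changes the quantum number `l` by at most one at a rate controlled by `χ` and `r`, and `HR`
preserves it.  The operators may be unbounded. -/
structure IsQuantumNumberHamiltonian {E : Type*} [NormedAddCommGroup E] [InnerProductSpace ℂ E]
    [CompleteSpace E] (V : ℤ → Submodule ℂ E) [∀ l, CompleteSpace (V l)]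
    (H HW HR : E →ₗ.[ℂ] E) (χ r : ℝ) : Prop where
  isHilbertSum : IsHilbertSum ℂ (fun l => V l) (fun l => (V l).subtypeₗᵢ)
  selfAdjoint : IsSelfAdjoint H
  selfAdjoint_HR : IsSelfAdjoint HR
  /-- `H` is a self-adjoint realization of the operator sum `HW + HR`, whose domain is the
  intersection of the two domains.  This covers both `H = HW + HR` and the case that `H` is the
  closure of an essentially self-adjoint sum. -/
  sum_le : HW + HR ≤ H
  χ_pos : 0 < χ
  r_nonneg : 0 ≤ r
  r_lt_one : r < 1
  /-- `Π_l HW Π_k = 0` if `|l - k| > 1`. -/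
  hopping : ∀ l k : ℤ, 1 < |l - k| → ∀ x : HW.domain, (x : E) ∈ V k →
    (V l).starProjection (HW x) = 0
  /-- `HW Π_{[-Λ,Λ]}` is an everywhere defined bounded operator of norm at most `χ (Λ+1)^r`. -/
  bound : ∀ (Λ : ℕ) (x : E), ∃ h : windowProj V Λ x ∈ HW.domain,
    ‖HW ⟨windowProj V Λ x, h⟩‖ ≤ χ * ((Λ : ℝ) + 1) ^ r * ‖x‖
  /-- `[HR, Π_l] = 0`: the projection `Π_l` maps the domain of `HR` to itself and commutes with
  `HR` there. -/
  commute : ∀ (l : ℤ) (x : HR.domain), ∃ h : (V l).starProjection (x : E) ∈ HR.domain,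
    HR ⟨(V l).starProjection (x : E), h⟩ = (V l).starProjection (HR x)

/-- The number of time steps
`⌈((a^{1-r} + 2χ|t|(1-r)(Δ-1))^{1/(1-r)} - a) / (Δ-1)⌉`; for `0 ≤ a`, `0 < χ`, `0 ≤ r < 1` and
`1 < Δ` the number under the ceiling is nonnegative. -/
def stepCount (a χ r t : ℝ) (Δ : ℕ) : ℕ :=
  ⌈((a ^ (1 - r) + 2 * χ * |t| * (1 - r) * ((Δ : ℝ) - 1)) ^ (1 / (1 - r)) - a)
    / ((Δ : ℝ) - 1)⌉₊

end

/-!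
Write `P_m` for the window projection `Π_{[-m,m]}` and `Q_m = 1 - P_m`.

**Short times.** The weight `‖Q_m ψ‖` of an evolving state `ψ(t) = e^{-itH} φ` changes only through
the part of `HW` that leads out of the window, so that formally
`d/dt ‖Q_m ψ‖ ≤ ‖Q_m HW P_m ψ‖ ≤ χ (m + 1) ^ r ‖Q_{m-1} ψ‖`, where the last step uses that `HW`
changes the quantum number by at most one.  Integrating this hierarchy, for `φ` in the window
`[-m, m]`, gives
`‖Q_{m+n} ψ(t)‖ ≤ (χ |t|) ^ (n+1) / (n+1)! * ((m+1) ⋯ (m+n+1)) ^ r * ‖φ‖`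
(`leakage_short_time_le`).  The identity behind it is the commutator formula for `[H, P_m]` on the
domain of `H` (`windowProj_mem_graph`): although `H` is only an extension of `HW + HR`, the
projection `P_m` maps the domain of `H` to the domain of `HR`, because `HR` commutes with `P_m`, is
self-adjoint, and differs from `H` by the bounded operator `HW P_m` on the range of `P_m`.  Hence
neither the group generated by `HR` nor a perturbation series is needed.

**Long times.** The window is enlarged by `n = Δ - 1` in each of `J` steps, and the leakages add up
(`leakage_le_of_steps`).  The `j`-th step takes the time
`τ_j = ((a + (j+1) n) ^ (1-r) - (a + j n) ^ (1-r)) / (2 χ (1-r) n)`, so that the sum telescopes and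
`J = stepCount a χ r t Δ` steps suffice.  As `2 χ τ_j` is the mean of `u ↦ u ^ (-r)` over an interval
of length `n`, each step leaks at most `2 ^ (-n) (Δ!) ^ (r-1)`.  For `a = Λ₀ + 1` this is immediate
from the value at the left end point; for `a = Λ₀` the factor `2` between `2 ^ (-Δ)` and
`2 ^ (-n)` is used up, and the steps that start from the windows `0` and `1` need separate estimates.

**Exponential bound.** It follows from the explicit one with `Δ - 1` the integer part of
`(Λ ^ (1-r) - Λ₀ ^ (1-r)) / (2 (1-r) χ t + 2)`; if that vanishes, the leakage is at most `1` anyway.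
-/

noncomputable section

/-! ### Window projections -/

section Window

variable {E : Type*} [NormedAddCommGroup E] [InnerProductSpace ℂ E]
  {V : ℤ → Submodule ℂ E} [∀ l, CompleteSpace (V l)]

theorem starProjection_mul_starProjection_of_orthogonalFamily
    (hV : OrthogonalFamily ℂ (fun l => V l) fun l => (V l).subtypeₗᵢ) (l k : ℤ) :
    (V l).starProjection * (V k).starProjection = if l = k then (V l).starProjection else 0 := by
  split_ifs with h
  · subst h
    exact (V l).isIdempotentElem_starProjection
  · exact (hV.isOrtho h).starProjection_comp_starProjection

theorem windowProj_mul_starProjection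
    (hV : OrthogonalFamily ℂ (fun l => V l) fun l => (V l).subtypeₗᵢ) (m : ℕ) (k : ℤ) :
    windowProj V m * (V k).starProjection = if |k| ≤ m then (V k).starProjection else 0 := by
  simp only [windowProj, Finset.sum_mul,
    starProjection_mul_starProjection_of_orthogonalFamily hV, Finset.sum_ite_eq', Finset.mem_Icc,
    abs_le]

theorem windowProj_mul_windowProj
    (hV : OrthogonalFamily ℂ (fun l => V l) fun l => (V l).subtypeₗᵢ) {m n : ℕ} (h : n ≤ m) :
    windowProj V m * windowProj V n = windowProj V n := by
  conv_lhs => rw [windowProj.eq_1 V n]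
  rw [Finset.mul_sum, windowProj.eq_1 V n]
  refine Finset.sum_congr rfl fun k hk => ?_
  rw [windowProj_mul_starProjection hV, if_pos]
  rw [Finset.mem_Icc] at hk
  rw [abs_le]
  omega

variable [CompleteSpace E]

theorem isSelfAdjoint_windowProj (m : ℕ) : IsSelfAdjoint (windowProj V m) :=
  isSelfAdjoint_sum _ fun l _ => isSelfAdjoint_starProjection (V l)

theorem inner_windowProj_left (m : ℕ) (x y : E) :
    ⟪windowProj V m x, y⟫_ℂ = ⟪x, windowProj V m y⟫_ℂ := by
  conv_lhs => rw [← (isSelfAdjoint_windowProj (V := V) m).star_eq]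
  exact ContinuousLinearMap.adjoint_inner_left _ _ _

theorem isStarProjection_windowProj
    (hV : OrthogonalFamily ℂ (fun l => V l) fun l => (V l).subtypeₗᵢ) (m : ℕ) :
    IsStarProjection (windowProj V m) :=
  ⟨windowProj_mul_windowProj hV le_rfl, isSelfAdjoint_windowProj m⟩

/-- The Hilbert sum is exhausted by the `V l`: a vector whose components outside the window all
vanish lies in the window. -/
theorem windowProj_apply_eq_self
    (hV : IsHilbertSum ℂ (fun l => V l) fun l => (V l).subtypeₗᵢ) (m : ℕ) {x : E}
    (hx : ∀ l : ℤ, (m : ℤ) < |l| → (V l).starProjection x = 0) : windowProj V m x = x := by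
  have hO := hV.OrthogonalFamily
  have key : ∀ l : ℤ, (V l).starProjection (x - windowProj V m x) = 0 := by
    intro l
    have h1 : (V l).starProjection * windowProj V m =
        if |l| ≤ m then (V l).starProjection else 0 := by
      have := congrArg star (windowProj_mul_starProjection (V := V) hO m l)
      rw [star_mul, (isSelfAdjoint_windowProj m).star_eq,
        (isSelfAdjoint_starProjection (V l)).star_eq] at this
      rw [this]
      split_ifs
      · exact (isSelfAdjoint_starProjection (V l)).star_eq
      · exact star_zero _
    have h2 : (V l).starProjection (windowProj V m x) =
        if |l| ≤ m then (V l).starProjection x else 0 := by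
      have := congrArg (fun T : E →L[ℂ] E => T x) h1
      simp only [mul_apply_eq_comp] at this
      rw [this]
      split_ifs <;> rfl
    rw [map_sub, h2]
    split_ifs with h
    · exact sub_self _
    · rw [hx l (not_le.mp h), sub_zero]
  obtain ⟨w, hw⟩ := hV.surjective_isometry (x - windowProj V m x)
  have hs := hO.hasSum_linearIsometry w
  rw [hw] at hs
  -- the residual `y = x - P x` is a convergent sum of vectors to which it is orthogonal
  have h0 : ⟪x - windowProj V m x, x - windowProj V m x⟫_ℂ = 0 := by
    have h1 := hs.mapL (innerSL ℂ (x - windowProj V m x))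
    refine h1.unique ?_
    convert hasSum_zero using 2 with l
    have h3 := (V l).starProjection_eq_self_iff.mpr (w l).2
    change ⟪x - windowProj V m x, ((w l : V l) : E)⟫_ℂ = 0
    rw [← h3, ← Submodule.inner_starProjection_left_eq_right, key l, inner_zero_left]
  exact (sub_eq_zero.mp (inner_self_eq_zero.mp h0)).symm

end Window

/-! ### Leakage -/

section Leakage

variable {E : Type*} [NormedAddCommGroup E] [InnerProductSpace ℂ E]
  {V : ℤ → Submodule ℂ E} [∀ l, CompleteSpace (V l)]

theorem one_sub_windowProj_mul
    (hV : OrthogonalFamily ℂ (fun l => V l) fun l => (V l).subtypeₗᵢ) {m n : ℕ} (h : n ≤ m) :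
    (1 - windowProj V m) * (1 - windowProj V n) = 1 - windowProj V m := by
  rw [sub_mul, mul_sub, mul_sub, windowProj_mul_windowProj hV h]
  simp

theorem leakage_one
    (hV : OrthogonalFamily ℂ (fun l => V l) fun l => (V l).subtypeₗᵢ) (m : ℕ) :
    leakage V (1 : E →L[ℂ] E) m m = 0 := by
  rw [leakage, mul_one, sub_mul, windowProj_mul_windowProj hV le_rfl, one_mul, sub_self, norm_zero]

variable [CompleteSpace E]

theorem norm_windowProj_le
    (hV : OrthogonalFamily ℂ (fun l => V l) fun l => (V l).subtypeₗᵢ) (m : ℕ) :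
    ‖windowProj V m‖ ≤ 1 :=
  (isStarProjection_windowProj hV m).norm_le

theorem norm_one_sub_windowProj_le
    (hV : OrthogonalFamily ℂ (fun l => V l) fun l => (V l).subtypeₗᵢ) (m : ℕ) :
    ‖1 - windowProj V m‖ ≤ 1 :=
  (isStarProjection_windowProj hV m).one_sub.norm_le

theorem leakage_le_norm
    (hV : OrthogonalFamily ℂ (fun l => V l) fun l => (V l).subtypeₗᵢ) (u : E →L[ℂ] E) (m n : ℕ) :
    leakage V u m n ≤ ‖u‖ := by
  calc leakage V u m n ≤ ‖1 - windowProj V n‖ * ‖u‖ * ‖windowProj V m‖ :=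
        (norm_mul_le _ _).trans (by gcongr; exact norm_mul_le _ _)
    _ ≤ 1 * ‖u‖ * 1 := by
        gcongr
        · exact norm_one_sub_windowProj_le hV n
        · exact norm_windowProj_le hV m
    _ = ‖u‖ := by ring

theorem leakage_anti
    (hV : OrthogonalFamily ℂ (fun l => V l) fun l => (V l).subtypeₗᵢ) (u : E →L[ℂ] E) (m : ℕ)
    {n n' : ℕ} (h : n ≤ n') : leakage V u m n' ≤ leakage V u m n := by
  unfold leakage
  rw [← one_sub_windowProj_mul hV h, mul_assoc, mul_assoc]
  refine (norm_mul_le _ _).trans ?_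
  rw [← mul_assoc]
  exact mul_le_of_le_one_left (norm_nonneg _) (norm_one_sub_windowProj_le hV n')

theorem leakage_mul_le
    (hV : OrthogonalFamily ℂ (fun l => V l) fun l => (V l).subtypeₗᵢ) {u v : E →L[ℂ] E}
    (hu : ‖u‖ ≤ 1) (hv : ‖v‖ ≤ 1) (l m n : ℕ) :
    leakage V (u * v) l n ≤ leakage V u m n + leakage V v l m := by
  have h : (1 - windowProj V n) * (u * v) * windowProj V l =
      (1 - windowProj V n) * u * windowProj V m * (v * windowProj V l) +
        (1 - windowProj V n) * u * ((1 - windowProj V m) * v * windowProj V l) := by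
    noncomm_ring
  unfold leakage
  rw [h]
  refine (norm_add_le _ _).trans (add_le_add ?_ ?_)
  · refine (norm_mul_le _ _).trans (mul_le_of_le_one_right (norm_nonneg _) ?_)
    exact (norm_mul_le _ _).trans (mul_le_one₀ hv (norm_nonneg _) (norm_windowProj_le hV l))
  · refine (norm_mul_le _ _).trans (mul_le_of_le_one_left (norm_nonneg _) ?_)
    exact (norm_mul_le _ _).trans
      (mul_le_one₀ (norm_one_sub_windowProj_le hV n) (norm_nonneg _) hu)

end Leakage

/-! ### Time evolution -/

namespace IsTimeEvolution

variable {E : Type*} [NormedAddCommGroup E] [InnerProductSpace ℂ E] [CompleteSpace E]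
  {H : E →ₗ.[ℂ] E} {U : ℝ → E →L[ℂ] E}

theorem map_zero (hU : IsTimeEvolution H U) : U 0 = 1 := by
  have h1 : U 0 * U 0 = U 0 := by rw [← hU.map_add, add_zero]
  have h2 := (Unitary.mem_iff.mp (hU.mem_unitary 0)).1
  calc U 0 = star (U 0) * U 0 * U 0 := by rw [h2, one_mul]
    _ = 1 := by rw [mul_assoc, h1, h2]

theorem norm_apply (hU : IsTimeEvolution H U) (t : ℝ) (x : E) : ‖U t x‖ = ‖x‖ :=
  (U t).norm_map_of_mem_unitary (hU.mem_unitary t) x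

theorem norm_le_one (hU : IsTimeEvolution H U) (t : ℝ) : ‖U t‖ ≤ 1 :=
  ContinuousLinearMap.opNorm_le_bound _ zero_le_one fun x => by rw [hU.norm_apply, one_mul]

theorem apply_mem_graph (hU : IsTimeEvolution H U) {x y : E} (h : (x, y) ∈ H.graph) (t : ℝ) :
    (U t x, U t y) ∈ H.graph := by
  rw [hU.mem_graph_iff] at h ⊢
  have h1 := ((U t).restrictScalars ℝ).hasFDerivAt.comp_hasDerivAt (0 : ℝ) h
  have h2 : (fun s => U s (U t x)) = ((U t).restrictScalars ℝ) ∘ fun s => U s x := by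
    funext s
    rw [Function.comp_apply, ContinuousLinearMap.coe_restrictScalars', ← mul_apply_eq_comp,
      ← mul_apply_eq_comp, ← hU.map_add, ← hU.map_add, add_comm]
  rw [h2]
  simpa using h1

theorem hasDerivAt_apply (hU : IsTimeEvolution H U) {x y : E} (h : (x, y) ∈ H.graph) (t : ℝ) :
    HasDerivAt (fun s => U s x) (-Complex.I • U t y) t := by
  have h1 := (hU.mem_graph_iff _ _).mp (hU.apply_mem_graph h t)
  have h2 : (fun s => U s x) = fun s => U (s - t) (U t x) := by
    funext s
    rw [← mul_apply_eq_comp, ← hU.map_add, sub_add_cancel]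
  rw [h2]
  refine HasDerivAt.scomp_of_eq (h := fun s : ℝ => s - t) t (g₁ := fun s => U s (U t x)) h1
    ((hasDerivAt_id t).sub_const t) (by simp) |>.congr_deriv (by simp)

end IsTimeEvolution

/-! ### A differential inequality for the norm of a curve -/

/-- The formal inequality `d/dt ‖w‖ ≤ b'` may be tested in the form `⟪w, w'⟫ ≤ ‖w‖ b'`, which makes
sense where `w` vanishes. -/
theorem norm_le_of_inner_deriv_le {F : Type*} [NormedAddCommGroup F] [InnerProductSpace ℝ F]
    {w w' : ℝ → F} {b b' : ℝ → ℝ} (hw : ∀ t, HasDerivAt w (w' t) t)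
    (hb : ∀ t, HasDerivAt b (b' t) t) (hw0 : w 0 = 0) (hb0 : b 0 = 0)
    (hb' : ∀ t, 0 ≤ t → 0 ≤ b' t)
    (h : ∀ t, 0 ≤ t → ⟪w t, w' t⟫_ℝ ≤ ‖w t‖ * b' t) {t : ℝ} (ht : 0 ≤ t) : ‖w t‖ ≤ b t := by
  refine le_of_forall_pos_le_add fun ε hε => ?_
  -- `√(‖w‖² + ε²)` is a differentiable substitute for `‖w‖`
  have hpos : ∀ s, 0 < ‖w s‖ ^ 2 + ε ^ 2 := fun s => by positivity
  have hF : ∀ s, HasDerivAt (fun s => b s - √(‖w s‖ ^ 2 + ε ^ 2))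
      (b' s - 2 * ⟪w s, w' s⟫_ℝ / (2 * √(‖w s‖ ^ 2 + ε ^ 2))) s := fun s =>
    (hb s).sub (((hw s).norm_sq.add_const (ε ^ 2)).sqrt (hpos s).ne')
  have hle : ∀ s, ‖w s‖ ≤ √(‖w s‖ ^ 2 + ε ^ 2) := fun s =>
    Real.le_sqrt_of_sq_le (by nlinarith [sq_nonneg ε])
  have hmono : MonotoneOn (fun s => b s - √(‖w s‖ ^ 2 + ε ^ 2)) (Set.Ici 0) := by
    refine monotoneOn_of_hasDerivWithinAt_nonneg (convex_Ici 0)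
      (fun s _ => (hF s).continuousAt.continuousWithinAt)
      (fun s _ => (hF s).hasDerivWithinAt) fun s hs => ?_
    rw [interior_Ici, Set.mem_Ioi] at hs
    rw [mul_div_mul_left _ _ two_ne_zero, sub_nonneg, div_le_iff₀ (Real.sqrt_pos.mpr (hpos s))]
    calc ⟪w s, w' s⟫_ℝ ≤ ‖w s‖ * b' s := h s hs.le
      _ ≤ √(‖w s‖ ^ 2 + ε ^ 2) * b' s := mul_le_mul_of_nonneg_right (hle s) (hb' s hs.le)
      _ = b' s * √(‖w s‖ ^ 2 + ε ^ 2) := mul_comm _ _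
  have h1 := hmono Set.self_mem_Ici (Set.mem_Ici.mpr ht) ht
  simp only [hw0, hb0, norm_zero] at h1
  have h2 : √((0 : ℝ) ^ 2 + ε ^ 2) = ε := by
    rw [zero_pow two_ne_zero, zero_add, Real.sqrt_sq hε.le]
  rw [h2] at h1
  linarith [hle t]

/-! ### The commutator of the Hamiltonian with a window projection -/

theorem LinearPMap.inner_eq_of_mem_graph_of_isSelfAdjoint {E : Type*} [NormedAddCommGroup E]
    [InnerProductSpace ℂ E] [CompleteSpace E] {A : E →ₗ.[ℂ] E} (hA : IsSelfAdjoint A)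
    {x y x' y' : E} (h : (x, y) ∈ A.graph) (h' : (x', y') ∈ A.graph) : ⟪y, x'⟫_ℂ = ⟪x, y'⟫_ℂ := by
  rw [← LinearPMap.isSelfAdjoint_def.mp hA, LinearPMap.adjoint_graph_eq_graph_adjoint
    hA.dense_domain, Submodule.mem_adjoint_iff] at h'
  exact sub_eq_zero.mp (h' x y h)

theorem LinearPMap.mem_graph_of_isSelfAdjoint {E : Type*} [NormedAddCommGroup E]
    [InnerProductSpace ℂ E] [CompleteSpace E] {A : E →ₗ.[ℂ] E} (hA : IsSelfAdjoint A) {v w : E}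
    (h : ∀ x y, (x, y) ∈ A.graph → ⟪y, v⟫_ℂ = ⟪x, w⟫_ℂ) : (v, w) ∈ A.graph := by
  rw [← LinearPMap.isSelfAdjoint_def.mp hA, LinearPMap.adjoint_graph_eq_graph_adjoint
    hA.dense_domain, Submodule.mem_adjoint_iff]
  exact fun x y hxy => sub_eq_zero.mpr (h x y hxy)

namespace IsQuantumNumberHamiltonian

variable {E : Type*} [NormedAddCommGroup E] [InnerProductSpace ℂ E] [CompleteSpace E]
  {V : ℤ → Submodule ℂ E} [∀ l, CompleteSpace (V l)] {H HW HR : E →ₗ.[ℂ] E} {χ r : ℝ}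

/-- The bounded operator `HW Π_{[-m,m]}`. -/
def hop (h : IsQuantumNumberHamiltonian V H HW HR χ r) (m : ℕ) : E →L[ℂ] E :=
  LinearMap.mkContinuous
    { toFun := fun x => HW ⟨windowProj V m x, (h.bound m x).1⟩
      map_add' := fun x y => by
        rw [← LinearPMap.map_add]
        congr 1
        exact Subtype.ext (map_add _ x y)
      map_smul' := fun c x => by
        rw [RingHom.id_apply, ← LinearPMap.map_smul]
        congr 1
        exact Subtype.ext (map_smul _ c x) }
    (χ * ((m : ℝ) + 1) ^ r) fun x => (h.bound m x).2

theorem hop_apply (h : IsQuantumNumberHamiltonian V H HW HR χ r) (m : ℕ) (x : E) :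
    h.hop m x = HW ⟨windowProj V m x, (h.bound m x).1⟩ := rfl

theorem norm_hop_apply_le (h : IsQuantumNumberHamiltonian V H HW HR χ r) (m : ℕ) (x : E) :
    ‖h.hop m x‖ ≤ χ * ((m : ℝ) + 1) ^ r * ‖x‖ := (h.bound m x).2

theorem windowProj_windowProj (h : IsQuantumNumberHamiltonian V H HW HR χ r) (m : ℕ) (x : E) :
    windowProj V m (windowProj V m x) = windowProj V m x :=
  congrArg (fun T : E →L[ℂ] E => T x)
    (windowProj_mul_windowProj h.isHilbertSum.OrthogonalFamily (le_refl m))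

theorem hop_windowProj (h : IsQuantumNumberHamiltonian V H HW HR χ r) (m : ℕ) (x : E) :
    h.hop m (windowProj V m x) = h.hop m x := by
  rw [hop_apply, hop_apply]
  congr 1
  exact Subtype.ext (h.windowProj_windowProj m x)

/-- `HW` moves a vector by at most one quantum number. -/
theorem windowProj_hop_windowProj (h : IsQuantumNumberHamiltonian V H HW HR χ r) {m n : ℕ}
    (hn : n < m) (x : E) :
    windowProj V m (h.hop m (windowProj V n x)) = h.hop m (windowProj V n x) := by
  rw [windowProj.eq_1 V n, sum_apply, map_sum, map_sum]
  refine Finset.sum_congr rfl fun k hk => ?_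
  rw [Finset.mem_Icc] at hk
  refine windowProj_apply_eq_self h.isHilbertSum m fun l hl => ?_
  have h1 : windowProj V m ((V k).starProjection x) = (V k).starProjection x := by
    have := congrArg (fun T : E →L[ℂ] E => T x)
      (windowProj_mul_starProjection h.isHilbertSum.OrthogonalFamily m k)
    simpa only [mul_apply_eq_comp, if_pos (show |k| ≤ (m : ℤ) by rw [abs_le]; omega)] using this
  rw [hop_apply]
  refine h.hopping l k ?_ _ ?_
  · have hk' : |k| ≤ (n : ℤ) := abs_le.mpr hk
    have := abs_sub_abs_le_abs_sub l k
    omega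
  · simp only [h1, Submodule.starProjection_apply_mem]

theorem windowProj_mem_graph_HR (h : IsQuantumNumberHamiltonian V H HW HR χ r) (m : ℕ) {x y : E}
    (hxy : (x, y) ∈ HR.graph) : (windowProj V m x, windowProj V m y) ∈ HR.graph := by
  have h1 : ∀ l : ℤ, ((V l).starProjection x, (V l).starProjection y) ∈ HR.graph := by
    intro l
    obtain ⟨x', rfl, rfl⟩ := (LinearPMap.mem_graph_iff _).mp hxy
    obtain ⟨h2, h3⟩ := h.commute l x'
    exact (LinearPMap.mem_graph_iff _).mpr ⟨⟨_, h2⟩, rfl, h3⟩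
  have h2 := Submodule.sum_mem HR.graph fun l (_ : l ∈ Finset.Icc (-(m : ℤ)) (m : ℤ)) => h1 l
  rw [windowProj, sum_apply, sum_apply]
  convert h2 using 1
  exact Prod.ext (by rw [Prod.fst_sum]) (by rw [Prod.snd_sum])

theorem windowProj_mem_graph_of_mem_graph_HR (h : IsQuantumNumberHamiltonian V H HW HR χ r) (m : ℕ)
    {x y : E} (hxy : (x, y) ∈ HR.graph) :
    (windowProj V m x, windowProj V m y + h.hop m x) ∈ H.graph := by
  refine LinearPMap.le_graph_of_le h.sum_le ?_
  obtain ⟨x', hx', hy'⟩ := (LinearPMap.mem_graph_iff _).mp (h.windowProj_mem_graph_HR m hxy)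
  obtain ⟨x', hx''⟩ := x'
  dsimp only at hx' hy'
  subst hx'
  refine (LinearPMap.mem_graph_iff _).mpr ⟨⟨windowProj V m x, (h.bound m x).1, hx''⟩, rfl, ?_⟩
  rw [LinearPMap.add_apply, add_comm]
  exact congrArg₂ (· + ·) hy' rfl

/-- The window projection maps the domain of `H` to that of `HR`.  The reason is that `HR`, being
self-adjoint, has no proper symmetric extension. -/
theorem windowProj_mem_graph_HR_of_mem_graph (h : IsQuantumNumberHamiltonian V H HW HR χ r) (m : ℕ)
    {x y : E} (hxy : (x, y) ∈ H.graph) :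
    (windowProj V m x, windowProj V m y - (h.hop m).adjoint x) ∈ HR.graph := by
  refine LinearPMap.mem_graph_of_isSelfAdjoint h.selfAdjoint_HR fun u v huv => ?_
  have h1 := LinearPMap.inner_eq_of_mem_graph_of_isSelfAdjoint h.selfAdjoint
    (h.windowProj_mem_graph_of_mem_graph_HR m huv) hxy
  rw [inner_add_left] at h1
  rw [inner_sub_right, ContinuousLinearMap.adjoint_inner_right, ← inner_windowProj_left,
    ← inner_windowProj_left, ← h1, add_sub_cancel_right]

theorem windowProj_mem_graph (h : IsQuantumNumberHamiltonian V H HW HR χ r) (m : ℕ)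
    {x y : E} (hxy : (x, y) ∈ H.graph) :
    (windowProj V m x, windowProj V m (y - (h.hop m).adjoint x) + h.hop m x) ∈ H.graph := by
  have h1 := h.windowProj_mem_graph_of_mem_graph_HR m (h.windowProj_mem_graph_HR_of_mem_graph m hxy)
  rwa [h.windowProj_windowProj, hop_windowProj, map_sub, h.windowProj_windowProj, ← map_sub] at h1

theorem inner_one_sub_windowProj_left (h : IsQuantumNumberHamiltonian V H HW HR χ r) (m : ℕ)
    (x y : E) : ⟪(1 - windowProj V m) x, (1 - windowProj V m) y⟫_ℂ =
      ⟪(1 - windowProj V m) x, y⟫_ℂ := by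
  have h1 : ⟪(1 - windowProj V m) x, windowProj V m y⟫_ℂ = 0 := by
    rw [← inner_windowProj_left, sub_apply, map_sub,
      one_apply_eq_self, h.windowProj_windowProj, sub_self, inner_zero_left]
  conv_lhs => rw [sub_apply (1 : E →L[ℂ] E) _ y, inner_sub_right, h1, sub_zero]
  rfl

/-- Only `HW` lets the weight outside a window grow. -/
theorem im_inner_one_sub_windowProj (h : IsQuantumNumberHamiltonian V H HW HR χ r) (m : ℕ)
    {x y : E} (hxy : (x, y) ∈ H.graph) :
    (⟪(1 - windowProj V m) x, y⟫_ℂ).im = (⟪(1 - windowProj V m) x, h.hop m x⟫_ℂ).im := by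
  set z := windowProj V m (y - (h.hop m).adjoint x) with hz
  have h1 : ((1 - windowProj V m) x, y - (z + h.hop m x)) ∈ H.graph :=
    Submodule.sub_mem _ hxy (h.windowProj_mem_graph m hxy)
  have h2 : (⟪(1 - windowProj V m) x, y - (z + h.hop m x)⟫_ℂ).im = 0 := by
    have := LinearPMap.inner_eq_of_mem_graph_of_isSelfAdjoint h.selfAdjoint h1 h1
    rw [← inner_conj_symm] at this
    exact Complex.conj_eq_iff_im.mp this
  have h3 : ⟪(1 - windowProj V m) x, z⟫_ℂ = 0 := by
    rw [← h.inner_one_sub_windowProj_left, sub_apply _ _ z,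
      one_apply_eq_self, hz, h.windowProj_windowProj, sub_self, inner_zero_right]
  rw [inner_sub_right, inner_add_right, h3, zero_add, Complex.sub_im, sub_eq_zero] at h2
  exact h2

theorem abs_im_inner_one_sub_windowProj_le (h : IsQuantumNumberHamiltonian V H HW HR χ r) (m : ℕ)
    {x y : E} (hxy : (x, y) ∈ H.graph) :
    |(⟪(1 - windowProj V m) x, y⟫_ℂ).im| ≤
      ‖(1 - windowProj V m) x‖ * ‖(1 - windowProj V m) (h.hop m x)‖ := by
  rw [h.im_inner_one_sub_windowProj m hxy, ← h.inner_one_sub_windowProj_left]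
  exact (Complex.abs_im_le_norm _).trans (norm_inner_le_norm _ _)

theorem norm_one_sub_windowProj_apply_le (h : IsQuantumNumberHamiltonian V H HW HR χ r) (m : ℕ)
    (x : E) : ‖(1 - windowProj V m) x‖ ≤ ‖x‖ :=
  ((1 - windowProj V m).le_opNorm x).trans (mul_le_of_le_one_left (norm_nonneg _)
    (norm_one_sub_windowProj_le h.isHilbertSum.OrthogonalFamily m))

theorem norm_one_sub_windowProj_hop_le (h : IsQuantumNumberHamiltonian V H HW HR χ r) (m : ℕ)
    (x : E) : ‖(1 - windowProj V m) (h.hop m x)‖ ≤ χ * ((m : ℝ) + 1) ^ r * ‖x‖ :=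
  (h.norm_one_sub_windowProj_apply_le m _).trans (h.norm_hop_apply_le m x)

/-- Only the part of `x` outside the next smaller window can be moved out of the window. -/
theorem norm_one_sub_windowProj_succ_hop_le (h : IsQuantumNumberHamiltonian V H HW HR χ r) (n : ℕ)
    (x : E) : ‖(1 - windowProj V (n + 1)) (h.hop (n + 1) x)‖ ≤
      χ * (((n + 1 : ℕ) : ℝ) + 1) ^ r * ‖(1 - windowProj V n) x‖ := by
  have h1 : (1 - windowProj V (n + 1)) (h.hop (n + 1) x) =
      (1 - windowProj V (n + 1)) (h.hop (n + 1) ((1 - windowProj V n) x)) := by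
    rw [sub_apply (1 : E →L[ℂ] E) (windowProj V n), map_sub, map_sub,
      one_apply_eq_self, sub_apply _ _ (h.hop (n + 1) (windowProj V n x)),
      h.windowProj_hop_windowProj n.lt_succ_self, one_apply_eq_self, sub_self, sub_zero]
  rw [h1]
  exact h.norm_one_sub_windowProj_hop_le _ _

/-! ### Leakage in a short time -/

variable {U : ℝ → E →L[ℂ] E}

/-- One step of the hierarchy of differential inequalities
`d/dt ‖(1 - P_m) ψ‖ ≤ ‖(1 - P_m) HW P_m ψ‖`; the sign `σ` gives the direction of time. -/
theorem norm_one_sub_windowProj_evolution_le (h : IsQuantumNumberHamiltonian V H HW HR χ r)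
    (hU : IsTimeEvolution H U) {x y : E} (hxy : (x, y) ∈ H.graph) {σ : ℝ} (hσ : |σ| ≤ 1) {m : ℕ}
    (hx : windowProj V m x = x) {b b' : ℝ → ℝ} (hb : ∀ t, HasDerivAt b (b' t) t) (hb0 : b 0 = 0)
    (hle : ∀ t, 0 ≤ t → ‖(1 - windowProj V m) (h.hop m (U (σ * t) x))‖ ≤ b' t) {t : ℝ}
    (ht : 0 ≤ t) : ‖(1 - windowProj V m) (U (σ * t) x)‖ ≤ b t := by
  have hψ : ∀ s : ℝ, HasDerivAt (fun s : ℝ => (1 - windowProj V m) (U (σ * s) x))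
      (σ • (1 - windowProj V m) (-Complex.I • U (σ * s) y)) s := by
    intro s
    have h1 := (hU.hasDerivAt_apply hxy (σ * s)).scomp s ((hasDerivAt_id s).const_mul σ)
    have h2 := ((1 - windowProj V m).restrictScalars ℝ).hasFDerivAt.comp_hasDerivAt s h1
    refine h2.congr_deriv ?_
    rw [mul_one, map_smul]
    rfl
  let _ : InnerProductSpace ℝ E := InnerProductSpace.complexToReal
  refine norm_le_of_inner_deriv_le hψ hb ?_ hb0 (fun s hs => (norm_nonneg _).trans (hle s hs))
    (fun s hs => ?_) ht
  · rw [mul_zero, hU.map_zero, one_apply_eq_self, sub_apply, one_apply_eq_self,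
      hx, sub_self]
  · have h1 := h.abs_im_inner_one_sub_windowProj_le m (hU.apply_mem_graph hxy (σ * s))
    rw [inner_smul_right, real_inner_eq_re_inner ℂ, map_smul, inner_smul_right,
      h.inner_one_sub_windowProj_left]
    have h2 : RCLike.re (-Complex.I * ⟪(1 - windowProj V m) (U (σ * s) x), U (σ * s) y⟫_ℂ) =
        (⟪(1 - windowProj V m) (U (σ * s) x), U (σ * s) y⟫_ℂ).im := by
      simp
    rw [h2]
    calc _ ≤ |σ * _| := le_abs_self _
      _ ≤ 1 * |(⟪(1 - windowProj V m) (U (σ * s) x), U (σ * s) y⟫_ℂ).im| := by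
          rw [abs_mul]
          gcongr
      _ ≤ _ := by
          rw [one_mul]
          exact h1.trans (by gcongr; exact hle s hs)

theorem norm_one_sub_windowProj_add_evolution_le (h : IsQuantumNumberHamiltonian V H HW HR χ r)
    (hU : IsTimeEvolution H U) {x y : E} (hxy : (x, y) ∈ H.graph) {σ : ℝ} (hσ : |σ| ≤ 1) {m : ℕ}
    (hx : windowProj V m x = x) (n : ℕ) {t : ℝ} (ht : 0 ≤ t) :
    ‖(1 - windowProj V (m + n)) (U (σ * t) x)‖ ≤
      (χ * t) ^ (n + 1) / (n + 1)! * ((m + 1).ascFactorial (n + 1) : ℝ) ^ r * ‖x‖ := by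
  -- the bounds solve the hierarchy with equality
  have hderiv : ∀ (n : ℕ) (s : ℝ), HasDerivAt
      (fun s => (χ * s) ^ (n + 1) / (n + 1)! * ((m + 1).ascFactorial (n + 1) : ℝ) ^ r * ‖x‖)
      (χ * (((m + n : ℕ) : ℝ) + 1) ^ r *
        ((χ * s) ^ n / n ! * ((m + 1).ascFactorial n : ℝ) ^ r * ‖x‖)) s := by
    intro n s
    have h1 := (((((hasDerivAt_id s).const_mul χ).pow (n + 1)).div_const ((n + 1)! : ℝ)).mul_const
      (((m + 1).ascFactorial (n + 1) : ℝ) ^ r)).mul_const ‖x‖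
    refine h1.congr_deriv ?_
    have h2 : (((m + 1).ascFactorial (n + 1) : ℕ) : ℝ) ^ r =
        (((m + n : ℕ) : ℝ) + 1) ^ r * ((m + 1).ascFactorial n : ℝ) ^ r := by
      rw [Nat.ascFactorial_succ, Nat.cast_mul, Real.mul_rpow (by positivity) (by positivity)]
      congr 2
      push_cast
      ring
    rw [h2, Nat.factorial_succ]
    push_cast
    have := Nat.factorial_pos n
    simp only [id_eq]
    field_simp
  have hwin : ∀ n : ℕ, windowProj V (m + n) x = x := by
    intro n
    have := congrArg (fun T : E →L[ℂ] E => T x) (windowProj_mul_windowProj (V := V)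
      h.isHilbertSum.OrthogonalFamily (Nat.le_add_right m n))
    simpa only [mul_apply_eq_comp, hx] using this
  have hχ : ∀ n : ℕ, 0 ≤ χ * (((m + n : ℕ) : ℝ) + 1) ^ r := fun n =>
    mul_nonneg h.χ_pos.le (by positivity)
  induction n generalizing t with
  | zero =>
    refine h.norm_one_sub_windowProj_evolution_le hU hxy hσ (hwin 0) (hderiv 0) (by simp)
      (fun s hs => ?_) ht
    refine (h.norm_one_sub_windowProj_hop_le _ _).trans ?_
    rw [hU.norm_apply]
    simp
  | succ n ih =>
    refine h.norm_one_sub_windowProj_evolution_le hU hxy hσ (hwin (n + 1)) (hderiv (n + 1))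
      (by simp) (fun s hs => ?_) ht
    exact (h.norm_one_sub_windowProj_succ_hop_le (m + n) _).trans
      (mul_le_mul_of_nonneg_left (ih hs) (hχ (n + 1)))

/-- The bound is that of the term of order `n + 1`, the first one to leave the window
`[-(m + n), m + n]`, in the perturbation series in `HW`. -/
theorem leakage_short_time_le (h : IsQuantumNumberHamiltonian V H HW HR χ r)
    (hU : IsTimeEvolution H U) (m n : ℕ) (t : ℝ) :
    leakage V (U t) m (m + n) ≤
      (χ * |t|) ^ (n + 1) / (n + 1)! * ((m + 1).ascFactorial (n + 1) : ℝ) ^ r := by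
  have hχ := h.χ_pos
  set c := (χ * |t|) ^ (n + 1) / (n + 1)! * ((m + 1).ascFactorial (n + 1) : ℝ) ^ r with hc
  have hc0 : 0 ≤ c := by positivity
  refine ContinuousLinearMap.opNorm_le_bound _ hc0 fun x => ?_
  refine h.selfAdjoint.dense_domain.induction (P := fun x =>
    ‖((1 - windowProj V (m + n)) * U t * windowProj V m) x‖ ≤ c * ‖x‖) (fun x hx => ?_)
    (isClosed_le (by fun_prop) (by fun_prop)) x
  have h1 := h.windowProj_mem_graph m (H.mem_graph ⟨x, hx⟩)
  obtain ⟨σ, hσ, hσt⟩ : ∃ σ : ℝ, |σ| ≤ 1 ∧ σ * |t| = t := by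
    rcases le_total 0 t with ht | ht
    · exact ⟨1, by simp, by rw [abs_of_nonneg ht, one_mul]⟩
    · exact ⟨-1, by simp, by rw [abs_of_nonpos ht, neg_one_mul, neg_neg]⟩
  have h2 := h.norm_one_sub_windowProj_add_evolution_le hU h1 hσ (h.windowProj_windowProj m x) n
    (abs_nonneg t)
  rw [hσt] at h2
  refine h2.trans (mul_le_mul_of_nonneg_left ?_ hc0)
  exact ((windowProj V m).le_opNorm x).trans (mul_le_of_le_one_left (norm_nonneg _)
    (norm_windowProj_le h.isHilbertSum.OrthogonalFamily m))

/-! ### Composition of short time steps -/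

/-- If the window may grow by `d` during each time `τ j` at the price of a leakage `ε`, then the
leakage adds up. -/
theorem leakage_le_of_steps (h : IsQuantumNumberHamiltonian V H HW HR χ r)
    (hU : IsTimeEvolution H U) (m d : ℕ) {τ : ℕ → ℝ} {ε : ℝ} (hτ : ∀ j, 0 ≤ τ j)
    (hstep : ∀ (j : ℕ) (s : ℝ), |s| ≤ τ j → leakage V (U s) (m + j * d) (m + j * d + d) ≤ ε)
    (J : ℕ) {t : ℝ} (ht : |t| ≤ ∑ j ∈ Finset.range J, τ j) :
    leakage V (U t) m (m + J * d) ≤ J * ε := by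
  have hO := h.isHilbertSum.OrthogonalFamily
  induction J generalizing t with
  | zero =>
    have : t = 0 := by simpa using ht
    rw [this, hU.map_zero, zero_mul, add_zero, leakage_one hO, Nat.cast_zero, zero_mul]
  | succ J ih =>
    rw [Finset.sum_range_succ] at ht
    set S := ∑ j ∈ Finset.range J, τ j
    have hS : 0 ≤ S := Finset.sum_nonneg fun j _ => hτ j
    obtain ⟨s, t', rfl, hs, ht'⟩ : ∃ s t', t = s + t' ∧ |s| ≤ τ J ∧ |t'| ≤ S := by
      rw [abs_le] at ht
      -- `t'` is `t` clamped to `[-S, S]`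
      -- `t'` is `t` clamped to `[-S, S]`
      refine ⟨t - max (-S) (min S t), max (-S) (min S t), by ring, ?_, ?_⟩
      · have := hτ J
        rw [abs_le]
        constructor <;> grind
      · rw [abs_le]
        constructor <;> grind
    rw [hU.map_add, Nat.cast_succ, add_mul J, one_mul, ← add_assoc, add_mul (J : ℝ), one_mul,
      add_comm (_ * ε)]
    exact (leakage_mul_le hO (hU.norm_le_one s) (hU.norm_le_one t') _ _ _).trans
      (add_le_add (hstep J s hs) (ih ht'))

end IsQuantumNumberHamiltonian

/-! ### Power and factorial estimates -/

/-- The tangent of the concave function `y ↦ y ^ (1 - r)` at `x` lies above its graph. -/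
theorem rpow_one_sub_add_sub_le {x d r : ℝ} (hx : 0 < x) (hd : 0 ≤ d) (hr0 : 0 ≤ r) (hr1 : r < 1) :
    (x + d) ^ (1 - r) - x ^ (1 - r) ≤ (1 - r) * d * x⁻¹ ^ r := by
  have h1 : (x + d) ^ (1 - r) = x ^ (1 - r) * (1 + d / x) ^ (1 - r) := by
    rw [← Real.mul_rpow hx.le (by positivity)]
    congr 1
    field_simp
  have h2 : (1 + d / x) ^ (1 - r) ≤ 1 + (1 - r) * (d / x) :=
    rpow_one_add_le_one_add_mul_self (by linarith [div_nonneg hd hx.le]) (by linarith)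
      (by linarith)
  have h3 : x ^ (1 - r) = x * x⁻¹ ^ r := by
    rw [Real.rpow_sub hx, Real.rpow_one, Real.inv_rpow hx.le, div_eq_mul_inv]
  calc (x + d) ^ (1 - r) - x ^ (1 - r)
      ≤ x ^ (1 - r) * (1 + (1 - r) * (d / x)) - x ^ (1 - r) := by
        rw [h1]
        gcongr
    _ = (1 - r) * d * x⁻¹ ^ r := by
        rw [h3]
        field_simp
        ring

/-- The trapezoidal rule overestimates the integral of the convex function `u ↦ u ^ (-r)` over
`[1, y]`. -/
theorem rpow_one_sub_sub_one_le {y r : ℝ} (hy : 1 ≤ y) (hr0 : 0 ≤ r) (hr1 : r < 1) :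
    y ^ (1 - r) - 1 ≤ (1 - r) * (y - 1) * ((1 + y ^ (-r)) / 2) := by
  have hd : ∀ u : ℝ, 0 < u →
      HasDerivAt (fun u : ℝ => (1 - r) * (u - 1) * ((1 + u ^ (-r)) / 2) - u ^ (1 - r))
        ((1 - r) * 1 * ((1 + u ^ (-r)) / 2) + (1 - r) * (u - 1) * ((-r * u ^ (-r - 1)) / 2)
          - (1 - r) * u ^ (1 - r - 1)) u := fun u hu =>
    ((((hasDerivAt_id u).sub_const 1).const_mul (1 - r)).mul
      (((Real.hasDerivAt_rpow_const (Or.inl hu.ne')).const_add 1).div_const 2)).sub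
      (Real.hasDerivAt_rpow_const (Or.inl hu.ne'))
  have hmono : MonotoneOn (fun u : ℝ => (1 - r) * (u - 1) * ((1 + u ^ (-r)) / 2) - u ^ (1 - r))
      (Set.Ici 1) := by
    refine monotoneOn_of_hasDerivWithinAt_nonneg (convex_Ici 1)
      (fun u hu => (hd u (zero_lt_one.trans_le hu)).continuousAt.continuousWithinAt)
      (fun u hu => (hd u (zero_lt_one.trans_le (interior_subset hu))).hasDerivWithinAt)
      fun u hu => ?_
    rw [interior_Ici, Set.mem_Ioi] at hu
    have hu0 : 0 < u := zero_lt_one.trans hu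
    set v := 1 - u⁻¹ with hv
    have hv0 : 0 ≤ v := sub_nonneg.mpr (inv_le_one_of_one_le₀ hu.le)
    have h1 : u ^ (-r) ≤ 1 - r * v := by
      rw [Real.rpow_neg hu0.le, ← Real.inv_rpow hu0.le]
      have := rpow_one_add_le_one_add_mul_self (s := -v) (p := r)
        (by rw [hv]; linarith [inv_pos.mpr hu0]) hr0 hr1.le
      rw [show 1 + -v = u⁻¹ by rw [hv]; ring] at this
      linarith
    have h2 : (u - 1) * u ^ (-r - 1) = v * u ^ (-r) := by
      rw [Real.rpow_sub hu0, Real.rpow_one, hv]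
      field_simp
    have h3 : u ^ (-r) * (1 + r * v) ≤ 1 := by
      nlinarith [mul_nonneg hr0 hv0, mul_le_mul_of_nonneg_right h1
        (show 0 ≤ 1 + r * v by positivity), sq_nonneg (r * v)]
    have h4 : 1 - r - 1 = -r := by ring
    rw [h4]
    have h5 : (1 - r) * 1 * ((1 + u ^ (-r)) / 2) + (1 - r) * (u - 1) * ((-r * u ^ (-r - 1)) / 2)
          - (1 - r) * u ^ (-r) = (1 - r) / 2 * (1 - u ^ (-r) * (1 + r * v)) := by
      linear_combination (-(1 - r) * r / 2) * h2
    rw [h5]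
    exact mul_nonneg (by linarith) (by linarith)
  have := hmono Set.self_mem_Ici (Set.mem_Ici.mpr hy) hy
  simp only [sub_self, mul_zero, zero_mul, Real.one_rpow, zero_sub] at this
  linarith

theorem ascFactorial_succ_le_pow_mul_factorial (l k : ℕ) :
    (l + 1).ascFactorial k ≤ (l + 1) ^ k * k ! := by
  induction k with
  | zero => simp
  | succ k ih =>
    rw [Nat.ascFactorial_succ, pow_succ, Nat.factorial_succ]
    calc (l + 1 + k) * (l + 1).ascFactorial k ≤ ((l + 1) * (k + 1)) * ((l + 1) ^ k * k !) := by
          gcongr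
          nlinarith
      _ = _ := by ring

theorem ascFactorial_succ_le_two_mul {l : ℕ} (hl : 2 ≤ l) (k : ℕ) :
    (l + 1).ascFactorial (k + 1) ≤ 2 * (l ^ (k + 1) * (k + 1)!) := by
  induction k with
  | zero => simp [Nat.ascFactorial_succ]; omega
  | succ k ih =>
    rw [Nat.ascFactorial_succ, pow_succ l (k + 1), Nat.factorial_succ (k + 1)]
    calc (l + 1 + (k + 1)) * (l + 1).ascFactorial (k + 1)
        ≤ (l * (k + 1 + 1)) * (2 * (l ^ (k + 1) * (k + 1)!)) := by
          gcongr
          nlinarith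
      _ = _ := by ring

theorem three_mul_le_two_pow (k : ℕ) : 3 * (k + 4) ≤ 2 * 2 ^ (k + 3) := by
  induction k with
  | zero => norm_num
  | succ k ih => rw [show k + 1 + 3 = k + 3 + 1 by ring, pow_succ]; omega

theorem half_one_add_inv_pow_mul_le {k : ℕ} (hk : 2 ≤ k) :
    ((1 + (k : ℝ)⁻¹) / 2) ^ k * (k + 1) ≤ 2 := by
  obtain rfl | hk3 := hk.eq_or_lt
  · norm_num
  have hk0 : (0 : ℝ) < k := by positivity
  have h1 : (1 + (k : ℝ)⁻¹) ^ k ≤ 3 := by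
    calc (1 + (k : ℝ)⁻¹) ^ k ≤ Real.exp ((k : ℝ)⁻¹) ^ k := by
          gcongr
          rw [add_comm]
          exact Real.add_one_le_exp _
      _ = Real.exp 1 := by rw [← Real.exp_nat_mul, mul_inv_cancel₀ hk0.ne']
      _ ≤ 3 := Real.exp_one_lt_three.le
  have h2 : (3 : ℝ) * (k + 1) ≤ 2 * 2 ^ k := by
    obtain ⟨i, rfl⟩ := Nat.exists_eq_add_of_le' hk3
    have := three_mul_le_two_pow i
    rify at this
    push_cast
    linarith
  rw [div_pow, div_mul_eq_mul_div, div_le_iff₀ (by positivity)]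
  exact (mul_le_mul_of_nonneg_right h1 (by positivity)).trans h2

/-- With `x = χ |s|` and `A = (m + 1) ⋯ (m + n + 1)`, the left side is the short-time leakage bound:
a time step `s` with `2 χ |s| ≤ z ^ r` is short enough if `z` satisfies `hz`. -/
theorem pow_div_factorial_mul_rpow_le {x z A r : ℝ} {n : ℕ} (hx : 0 ≤ x) (hz0 : 0 ≤ z) (hA : 0 ≤ A)
    (hr0 : 0 ≤ r) (hr1 : r < 1) (hxz : x ≤ z ^ r / 2) (hz : z ^ (n + 1) * A ≤ 2 * (n + 1)!) :
    x ^ (n + 1) / (n + 1)! * A ^ r ≤ 1 / (2 ^ n * ((n + 1)! : ℝ) ^ (1 - r)) := by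
  have hf : (0 : ℝ) < (n + 1)! := by positivity
  have h1 : (z ^ r) ^ (n + 1) * A ^ r ≤ 2 * ((n + 1)! : ℝ) ^ r := by
    calc (z ^ r) ^ (n + 1) * A ^ r = (z ^ (n + 1) * A) ^ r := by
          rw [Real.mul_rpow (by positivity) hA, Real.rpow_pow_comm hz0]
      _ ≤ (2 * (n + 1)!) ^ r := Real.rpow_le_rpow (by positivity) hz hr0
      _ = 2 ^ r * ((n + 1)! : ℝ) ^ r := Real.mul_rpow zero_le_two hf.le
      _ ≤ 2 * ((n + 1)! : ℝ) ^ r := by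
          gcongr
          exact Real.rpow_le_self_of_one_le one_le_two hr1.le
  calc x ^ (n + 1) / (n + 1)! * A ^ r ≤ (z ^ r / 2) ^ (n + 1) / (n + 1)! * A ^ r := by gcongr
    _ = (z ^ r) ^ (n + 1) * A ^ r / (2 ^ (n + 1) * (n + 1)!) := by
        rw [div_pow]
        field_simp
    _ ≤ 2 * ((n + 1)! : ℝ) ^ r / (2 ^ (n + 1) * (n + 1)!) := by gcongr
    _ = 1 / (2 ^ n * ((n + 1)! : ℝ) ^ (1 - r)) := by
        rw [Real.rpow_sub hf, Real.rpow_one, pow_succ]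
        have := Real.rpow_pos_of_pos hf r
        field_simp

theorem le_rpow_of_stepCount {a χ r t : ℝ} {n : ℕ} (hn : 1 ≤ n) (ha : 0 ≤ a) (hχ : 0 < χ)
    (hr1 : r < 1) :
    a ^ (1 - r) + 2 * χ * |t| * (1 - r) * n ≤ (a + stepCount a χ r t (n + 1) * n) ^ (1 - r) := by
  have hn0 : (0 : ℝ) < n := by positivity
  have hr : 0 < 1 - r := by linarith
  set B := a ^ (1 - r) + 2 * χ * |t| * (1 - r) * n with hB
  have hB0 : 0 ≤ B := by positivity
  have h1 : (B ^ (1 / (1 - r)) - a) / n ≤ stepCount a χ r t (n + 1) := by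
    have := Nat.le_ceil ((B ^ (1 / (1 - r)) - a) / n)
    simpa only [stepCount, Nat.cast_add_one, add_sub_cancel_right] using this
  rw [div_le_iff₀ hn0] at h1
  calc B = (B ^ (1 / (1 - r))) ^ (1 - r) := by
        rw [← Real.rpow_mul hB0, one_div_mul_cancel hr.ne', Real.rpow_one]
    _ ≤ _ := Real.rpow_le_rpow (by positivity) (by linarith) hr.le

/-! ### The leakage bounds -/

namespace IsQuantumNumberHamiltonian

variable {E : Type*} [NormedAddCommGroup E] [InnerProductSpace ℂ E] [CompleteSpace E]
  {V : ℤ → Submodule ℂ E} [∀ l, CompleteSpace (V l)] {H HW HR : E →ₗ.[ℂ] E} {χ r : ℝ}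
  {U : ℝ → E →L[ℂ] E}

/-- The explicit bound, with the start `a` of the time grid left open.  The time step `τ j` is
chosen such that the total time telescopes, and `z` bounds it from above: `2 χ τ j ≤ z ^ r`. -/
theorem leakage_stepCount_le (h : IsQuantumNumberHamiltonian V H HW HR χ r)
    (hU : IsTimeEvolution H U) (m : ℕ) {n : ℕ} (hn : 1 ≤ n) {a : ℝ} (ha : 0 ≤ a) (t : ℝ)
    (hstep : ∀ j : ℕ, ∃ z : ℝ, 0 ≤ z ∧
      (a + j * n + n) ^ (1 - r) - (a + j * n) ^ (1 - r) ≤ (1 - r) * n * z ^ r ∧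
      z ^ (n + 1) * ((m + j * n + 1).ascFactorial (n + 1) : ℝ) ≤ 2 * (n + 1)!) :
    leakage V (U t) m (m + stepCount a χ r t (n + 1) * n) ≤
      stepCount a χ r t (n + 1) / (2 ^ n * ((n + 1)! : ℝ) ^ (1 - r)) := by
  have hn0 : (0 : ℝ) < n := by positivity
  have hr : 0 < 1 - r := by linarith [h.r_lt_one]
  have hχ := h.χ_pos
  have hc : 0 < 2 * χ * (1 - r) * n := by positivity
  set τ : ℕ → ℝ := fun j =>
    ((a + ((j + 1 : ℕ) : ℝ) * n) ^ (1 - r) - (a + j * n) ^ (1 - r)) / (2 * χ * (1 - r) * n) with hτ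
  have hτ0 : ∀ j, 0 ≤ τ j := by
    intro j
    refine div_nonneg (sub_nonneg.mpr ?_) hc.le
    gcongr
    exact j.le_succ
  rw [div_eq_mul_one_div]
  refine h.leakage_le_of_steps hU m n hτ0 (fun j s hs => ?_) _ ?_
  · obtain ⟨z, hz0, hz1, hz2⟩ := hstep j
    refine (h.leakage_short_time_le hU _ n s).trans ?_
    refine pow_div_factorial_mul_rpow_le (by positivity) hz0 (by positivity) h.r_nonneg h.r_lt_one
      ?_ hz2
    rw [hτ, le_div_iff₀ hc] at hs
    have h1 : a + ((j + 1 : ℕ) : ℝ) * n = a + j * n + n := by push_cast; ring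
    rw [h1] at hs
    have h2 : (1 - r) * n * (2 * (χ * |s|)) ≤ (1 - r) * n * z ^ r := by linarith
    linarith [le_of_mul_le_mul_left h2 (by positivity)]
  · rw [hτ, ← Finset.sum_div,
      Finset.sum_range_sub fun j : ℕ => (a + (j : ℝ) * n) ^ (1 - r), le_div_iff₀ hc]
    have := le_rpow_of_stepCount (t := t) hn ha hχ h.r_lt_one
    rw [Nat.cast_zero, zero_mul, add_zero]
    linarith

/-- The grid starts at `a = m + 1`, and `z` is the reciprocal of the left end point of the step. -/
theorem leakage_stepCount_add_one_le (h : IsQuantumNumberHamiltonian V H HW HR χ r)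
    (hU : IsTimeEvolution H U) (m : ℕ) {n : ℕ} (hn : 1 ≤ n) (t : ℝ) :
    leakage V (U t) m (m + stepCount ((m : ℝ) + 1) χ r t (n + 1) * n) ≤
      stepCount ((m : ℝ) + 1) χ r t (n + 1) / (2 ^ n * ((n + 1)! : ℝ) ^ (1 - r)) := by
  refine h.leakage_stepCount_le hU m hn (by positivity) t fun j => ?_
  refine ⟨((m : ℝ) + 1 + j * n)⁻¹, by positivity,
    rpow_one_sub_add_sub_le (by positivity) (by positivity) h.r_nonneg h.r_lt_one, ?_⟩
  have h1 := ascFactorial_succ_le_pow_mul_factorial (m + j * n) (n + 1)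
  rify at h1
  rw [inv_pow, inv_mul_le_iff₀ (by positivity)]
  calc _ ≤ _ := h1
    _ = ((m : ℝ) + 1 + j * n) ^ (n + 1) * (1 * (n + 1)!) := by ring
    _ ≤ _ := by gcongr; exact one_le_two

/-- The grid starts at `a = m`.  A step from the window `l ≥ 2` is certified by `z = 1 / l`.  From
`l = 1` this `z` is too large, and a step from `l = 0` needs the condition on `n`. -/
theorem leakage_stepCount_self_le (h : IsQuantumNumberHamiltonian V H HW HR χ r)
    (hU : IsTimeEvolution H U) (m : ℕ) {n : ℕ} (hn : 1 ≤ n) (t : ℝ)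
    (hm : 1 ≤ m ∨ 1 ≤ (1 - r) * (n : ℝ) ^ r) :
    leakage V (U t) m (m + stepCount (m : ℝ) χ r t (n + 1) * n) ≤
      stepCount (m : ℝ) χ r t (n + 1) / (2 ^ n * ((n + 1)! : ℝ) ^ (1 - r)) := by
  have hr0 := h.r_nonneg
  have hr1 := h.r_lt_one
  have hn0 : (0 : ℝ) < n := by positivity
  refine h.leakage_stepCount_le hU m hn (by positivity) t fun j => ?_
  have hl : (m : ℝ) + j * n = ((m + j * n : ℕ) : ℝ) := by push_cast; ring
  rw [hl]
  have hm' : 1 ≤ m + j * n ∨ m + j * n = 0 ∧ 1 ≤ (1 - r) * (n : ℝ) ^ r := by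
    rcases hm with hm | hm
    · exact Or.inl (by omega)
    · rcases Nat.eq_zero_or_pos (m + j * n) with h0 | h0
      · exact Or.inr ⟨h0, hm⟩
      · exact Or.inl h0
  generalize m + j * n = l at hm' ⊢
  rcases hm' with hl | ⟨rfl, hm⟩
  · obtain rfl | hl2 := hl.eq_or_lt
    · -- `z` is the mean of `1` and `1 / (n + 1)`, by the trapezoidal rule and Jensen's inequality
      refine ⟨(1 + ((n + 1 : ℕ) : ℝ)⁻¹) / 2, by positivity, ?_, ?_⟩
      · have h1 := rpow_one_sub_sub_one_le (y := 1 + (n : ℝ)) (by linarith) hr0 hr1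
        have h2 := (Real.concaveOn_rpow hr0 hr1.le).2 (Set.mem_Ici.mpr zero_le_one)
          (Set.mem_Ici.mpr (show (0 : ℝ) ≤ ((n + 1 : ℕ) : ℝ)⁻¹ by positivity))
          (show (0 : ℝ) ≤ 1 / 2 by norm_num) (show (0 : ℝ) ≤ 1 / 2 by norm_num) (by norm_num)
        simp only [smul_eq_mul, Real.one_rpow] at h2
        have h3 : ((n + 1 : ℕ) : ℝ)⁻¹ ^ r = (1 + (n : ℝ)) ^ (-r) := by
          rw [Real.rpow_neg (by positivity), Real.inv_rpow (by positivity)]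
          push_cast
          rw [add_comm]
        have h4 : (1 + (1 + (n : ℝ)) ^ (-r)) / 2 ≤ ((1 + ((n + 1 : ℕ) : ℝ)⁻¹) / 2) ^ r := by
          rw [← h3]
          refine le_trans (le_of_eq ?_) (h2.trans_eq ?_)
          · ring
          · congr 1
            ring
        rw [Nat.cast_one, Real.one_rpow]
        refine h1.trans ?_
        rw [add_sub_cancel_left]
        have : 0 ≤ 1 - r := by linarith
        gcongr
      · have h1 := half_one_add_inv_pow_mul_le (k := n + 1) (by omega)
        have h2 : (1 + 1).ascFactorial (n + 1) = (n + 1 + 1) * (n + 1)! := by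
          have := Nat.factorial_mul_ascFactorial 1 (n + 1)
          rw [Nat.factorial_one, one_mul] at this
          rw [this, ← Nat.factorial_succ]
          congr 1
          ring
        rw [h2]
        have hf : (0 : ℝ) ≤ (n + 1)! := by positivity
        rw [Nat.cast_mul, ← mul_assoc, Nat.cast_succ (n + 1)]
        exact mul_le_mul_of_nonneg_right h1 hf
    · have hl2' : 2 ≤ l := hl2
      have hl0 : (0 : ℝ) < l := by positivity
      refine ⟨(l : ℝ)⁻¹, by positivity, rpow_one_sub_add_sub_le hl0 hn0.le hr0 hr1, ?_⟩
      have h1 := ascFactorial_succ_le_two_mul hl2' n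
      rify at h1
      rw [inv_pow, inv_mul_le_iff₀ (by positivity)]
      linarith
  · refine ⟨1, zero_le_one, ?_, ?_⟩
    · have h1 : (n : ℝ) ^ (1 - r) * (n : ℝ) ^ r = n := by
        rw [← Real.rpow_add hn0, sub_add_cancel, Real.rpow_one]
      have h2 := Real.rpow_nonneg hn0.le (1 - r)
      rw [Nat.cast_zero, zero_add, Real.zero_rpow (by linarith), sub_zero, Real.one_rpow]
      nlinarith
    · rw [zero_add, Nat.one_ascFactorial, one_pow, one_mul]
      linarith [show (0 : ℝ) ≤ (n + 1)! by positivity]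

/-- For `n` up to `(N ^ (1 - r) - m ^ (1 - r)) / (2 (1 - r) χ |t| + 2)` the target window of the
explicit bound still lies in `[-N, N]`.  The summand `2` absorbs the rounding in `stepCount` and the
difference between `m + 1` and `m`. -/
theorem add_stepCount_mul_le {χ r t : ℝ} (hχ : 0 < χ) (hr0 : 0 ≤ r) (hr1 : r < 1) {m n N : ℕ}
    (hn : 1 ≤ n)
    (hle : n * (2 * (1 - r) * χ * |t| + 2) ≤ (N : ℝ) ^ (1 - r) - (m : ℝ) ^ (1 - r)) :
    m + stepCount ((m : ℝ) + 1) χ r t (n + 1) * n ≤ N := by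
  have hn0 : (0 : ℝ) < n := by positivity
  have hn1 : (1 : ℝ) ≤ n := by exact_mod_cast hn
  have hr : 0 < 1 - r := by linarith
  set B := ((m : ℝ) + 1) ^ (1 - r) + 2 * χ * |t| * (1 - r) * n with hB
  have hB0 : 0 ≤ B := by positivity
  set A := B ^ (1 / (1 - r)) with hA
  have hA0 : 0 ≤ A := by positivity
  have hAB : A ^ (1 - r) = B := by
    rw [hA, ← Real.rpow_mul hB0, one_div_mul_cancel hr.ne', Real.rpow_one]
  have hmA : (m : ℝ) + 1 ≤ A := by
    refine (Real.rpow_le_rpow_iff (by positivity) hA0 hr).mp ?_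
    rw [hAB, hB]
    exact le_add_of_nonneg_right (by positivity)
  have hJ : (stepCount ((m : ℝ) + 1) χ r t (n + 1) : ℝ) < (A - (m + 1)) / n + 1 := by
    have := Nat.ceil_lt_add_one (a := (A - ((m : ℝ) + 1)) / n)
      (div_nonneg (by linarith) hn0.le)
    simpa only [stepCount, Nat.cast_add_one, add_sub_cancel_right] using this
  have hJn : (stepCount ((m : ℝ) + 1) χ r t (n + 1) : ℝ) * n ≤ A - (m + 1) + n := by
    have := mul_le_mul_of_nonneg_right hJ.le hn0.le
    rwa [add_mul, div_mul_cancel₀ _ hn0.ne', one_mul] at this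
  have hAn : A + n ≤ N := by
    refine (Real.rpow_le_rpow_iff (by positivity) (by positivity) hr).mp ?_
    have h1 : (A + n) ^ (1 - r) ≤ A ^ (1 - r) + (n : ℝ) ^ (1 - r) :=
      Real.rpow_add_le_add_rpow hA0 hn0.le hr.le (by linarith)
    have h2 : ((m : ℝ) + 1) ^ (1 - r) ≤ (m : ℝ) ^ (1 - r) + 1 ^ (1 - r) :=
      Real.rpow_add_le_add_rpow (by positivity) zero_le_one hr.le (by linarith)
    have h3 : (n : ℝ) ^ (1 - r) ≤ n := Real.rpow_le_self_of_one_le hn1 (by linarith)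
    rw [Real.one_rpow] at h2
    rw [hAB, hB] at h1
    linarith
  rify
  linarith

/-- The term `2` of the prefactor covers the case that the explicit bound is void, that is
`⌊D / (s + 2)⌋ = 0`; the term `2 * N` comes from `stepCount ≤ N` and the rounding of the exponent. -/
theorem leakage_le_exp (h : IsQuantumNumberHamiltonian V H HW HR χ r)
    (hU : IsTimeEvolution H U) {t : ℝ} {m N : ℕ} (ht : 0 ≤ t) (hmN : m ≤ N) :
    leakage V (U t) m N ≤ (2 * N + 2) *
      Real.exp (-(Real.log 2 / 2 * (((N : ℝ) ^ (1 - r) - (m : ℝ) ^ (1 - r)) /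
        (2 * (1 - r) * χ * t + 1)))) := by
  have hO := h.isHilbertSum.OrthogonalFamily
  have hr : 0 < 1 - r := by linarith [h.r_lt_one]
  have hχ := h.χ_pos
  have hlog : 0 < Real.log 2 := Real.log_pos one_lt_two
  set s := 2 * (1 - r) * χ * t with hs
  have hs0 : 0 ≤ s := by positivity
  set D := (N : ℝ) ^ (1 - r) - (m : ℝ) ^ (1 - r) with hD
  have hD0 : 0 ≤ D := sub_nonneg.mpr (by gcongr)
  set n := ⌊D / (s + 2)⌋₊ with hn
  have hDs : D / (s + 1) / 2 ≤ D / (s + 2) := by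
    rw [div_div]
    gcongr
    linarith
  have hexp : (1 / 2 : ℝ) ^ n ≤ 2 * Real.exp (-(Real.log 2 / 2 * (D / (s + 1)))) := by
    have h1 : D / (s + 2) < n + 1 := Nat.lt_floor_add_one _
    have h2 : (1 / 2 : ℝ) ^ n = Real.exp (-(n * Real.log 2)) := by
      rw [Real.exp_neg, Real.exp_nat_mul, Real.exp_log two_pos, one_div, inv_pow]
    have h3 : (2 : ℝ) = Real.exp (Real.log 2) := (Real.exp_log two_pos).symm
    rw [h2]
    conv_rhs => rw [h3, ← Real.exp_add, Real.exp_log two_pos]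
    refine Real.exp_le_exp.mpr ?_
    nlinarith
  have hN : (0 : ℝ) ≤ N := by positivity
  rcases Nat.eq_zero_or_pos n with h0 | hpos
  · rw [h0, pow_zero] at hexp
    calc leakage V (U t) m N ≤ 1 := (leakage_le_norm hO _ _ _).trans (hU.norm_le_one t)
      _ ≤ 2 * Real.exp (-(Real.log 2 / 2 * (D / (s + 1)))) := hexp
      _ ≤ _ := by gcongr; linarith
  · have hle : n * (2 * (1 - r) * χ * |t| + 2) ≤ D := by
      rw [abs_of_nonneg ht, ← hs, ← le_div_iff₀ (by linarith)]
      exact Nat.floor_le (by positivity)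
    have hwin := add_stepCount_mul_le hχ h.r_nonneg h.r_lt_one hpos hle
    have hJ : (stepCount ((m : ℝ) + 1) χ r t (n + 1) : ℝ) ≤ N := by
      have : stepCount ((m : ℝ) + 1) χ r t (n + 1) ≤ N := by nlinarith
      exact_mod_cast this
    have hfac : (1 : ℝ) ≤ ((n + 1)! : ℝ) ^ (1 - r) :=
      Real.one_le_rpow (by exact_mod_cast Nat.factorial_pos (n + 1)) hr.le
    calc leakage V (U t) m N
        ≤ leakage V (U t) m (m + stepCount ((m : ℝ) + 1) χ r t (n + 1) * n) :=
          leakage_anti hO _ _ hwin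
      _ ≤ stepCount ((m : ℝ) + 1) χ r t (n + 1) / (2 ^ n * ((n + 1)! : ℝ) ^ (1 - r)) :=
          h.leakage_stepCount_add_one_le hU m hpos t
      _ ≤ N / (2 ^ n * 1) := by gcongr
      _ = N * (1 / 2) ^ n := by rw [mul_one, one_div, inv_pow, div_eq_mul_inv]
      _ ≤ N * (2 * Real.exp (-(Real.log 2 / 2 * (D / (s + 1))))) := by gcongr
      _ ≤ _ := by
          rw [← mul_assoc]
          gcongr
          linarith

end IsQuantumNumberHamiltonian

end

theorem mainTheorem1 :
    -- exponential suppression of the leakage, with a polynomial and a rate that are universal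
    (∃ (p : MvPolynomial (Fin 3) ℝ) (c : ℝ), 0 < c ∧
      ∀ (E : Type*) [NormedAddCommGroup E] [InnerProductSpace ℂ E] [CompleteSpace E]
        (V : ℤ → Submodule ℂ E) [∀ l, CompleteSpace (V l)] (H HW HR : E →ₗ.[ℂ] E) (χ r : ℝ)
        (U : ℝ → E →L[ℂ] E),
        IsQuantumNumberHamiltonian V H HW HR χ r → IsTimeEvolution H U →
        ∀ (t : ℝ) (Λ₀ Λ : ℕ), 0 ≤ t → Λ₀ ≤ Λ →
          leakage V (U t) Λ₀ Λ ≤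
            MvPolynomial.eval ![χ * t, (Λ₀ : ℝ), (Λ : ℝ)] p *
              Real.exp (-(c * (((Λ : ℝ) ^ (1 - r) - (Λ₀ : ℝ) ^ (1 - r)) /
                (2 * (1 - r) * χ * t + 1))))) ∧
    -- the explicit bounds
    (∀ (E : Type*) [NormedAddCommGroup E] [InnerProductSpace ℂ E] [CompleteSpace E]
        (V : ℤ → Submodule ℂ E) [∀ l, CompleteSpace (V l)] (H HW HR : E →ₗ.[ℂ] E) (χ r : ℝ)
        (U : ℝ → E →L[ℂ] E),
        IsQuantumNumberHamiltonian V H HW HR χ r → IsTimeEvolution H U →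
        ∀ (t : ℝ) (Λ₀ Δ : ℕ), 1 < Δ →
          ((1 ≤ Λ₀ ∨ 1 ≤ (1 - r) * ((Δ : ℝ) - 1) ^ r) →
            leakage V (U t) Λ₀ (Λ₀ + stepCount (Λ₀ : ℝ) χ r t Δ * (Δ - 1)) ≤
              (stepCount (Λ₀ : ℝ) χ r t Δ : ℝ) / (2 ^ (Δ - 1) * (Δ ! : ℝ) ^ (1 - r))) ∧
          leakage V (U t) Λ₀ (Λ₀ + stepCount ((Λ₀ : ℝ) + 1) χ r t Δ * (Δ - 1)) ≤
            (stepCount ((Λ₀ : ℝ) + 1) χ r t Δ : ℝ) / (2 ^ (Δ - 1) * (Δ ! : ℝ) ^ (1 - r))) := by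
  refine ⟨⟨MvPolynomial.C 2 * MvPolynomial.X 2 + MvPolynomial.C 2, Real.log 2 / 2,
    half_pos (Real.log_pos one_lt_two), ?_⟩, ?_⟩
  · intro E _ _ _ V _ H HW HR χ r U h hU t Λ₀ Λ ht hΛ
    simpa using h.leakage_le_exp hU ht hΛ
  · intro E _ _ _ V _ H HW HR χ r U h hU t Λ₀ Δ hΔ
    obtain ⟨n, rfl⟩ : ∃ n, Δ = n + 1 := ⟨Δ - 1, by omega⟩
    have hn : 1 ≤ n := by omega
    simp only [Nat.add_sub_cancel, Nat.cast_add_one, add_sub_cancel_right]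
    exact ⟨h.leakage_stepCount_self_le hU Λ₀ hn t, h.leakage_stepCount_add_one_le hU Λ₀ hn t⟩
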